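/- Let $f$ be a Cauchy--Stieltjes function: there is a positive measure $\mu$ on $[0,\infty)$ such that $f(z)=\int_0^\infty \frac{d\mu(t)}{t+z}$ (convergent) for all $z\in\mathbb C\setminus(-\infty,0]$. Let $0<a$, and let $A,-B\in\mathbb C^{n\times n}$ be Hermitian positive definite with spectra contained in $[a,b]$; put $\kappa=b/a$. Let $I_A,I_B\subset\mathbb R$ be closed bounded intervals containing the spectra of $A$ and $B$, respectively (for instance $I_A=[a,b]$, $I_B=[-b,-a]$). Let $F=U_FV_F^T$ with $U_F,V_F\in\mathbb C^{n\times k}$, let $\mathcal M=I\otimes A-B^T\otimes I$, and let $X\in\mathbb C^{n\times n}$ be given by $\mathrm{vec}(X)=f(\mathcal M)\,\mathrm{vec}(F)$. Let $\Psi=(\psi_1,\dots,\psi_\ell)$ and $\Xi=(\xi_1,\dots,\xi_\ell)$ be arbitrary tuples in $\overline{\mathbb C}=\mathbb C\cup\{\infty\}$ such that no $\psi_j$ is an eigenvalue of $A$ and no $\xi_j$ is an eigenvalue of $B$. For a matrix $C$, a block vector $v$ and poles $\Psi$, the rational Krylov space $\mathcal{RK}_\ell(C,v,\Psi)$ is the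 span of the columns of $q(C)^{-1}C^jv$, $0\le j\le\ell$, where $q(z)=\prod_{\psi_j\ne\infty}(z-\psi_j)$. Let the columns of $U$ be an orthonormal basis of $\mathcal{RK}_\ell(A,U_F,\Psi)$, and let $V$ be such that the columns of its entrywise complex conjugate $\overline V$ are an orthonormal basis of $\mathcal{RK}_\ell(B^T,V_F,\Xi)$. Put $A_\ell=U^*AU$, $B_\ell=V^*BV$, let $Y$ be given by $\mathrm{vec}(Y)=f(I\otimes A_\ell-B_\ell^T\otimes I)\,\mathrm{vec}(U^*U_F\,V_F^TV)$, and let $X_\ell=UYV^*$. For $I_1,I_2\subset\mathbb C$ define $$\theta_\ell(I_1,I_2,\Psi)=\inf_{r\in\mathcal P_\ell/\Psi}\frac{\sup_{I_1}|r|}{\inf_{I_2}|r|},$$ where $\mathcal P_\ell/\Psi$ is the set of rational functions $g/\prod_{\psi_j\neq\infty}(z-\psi_j)$ with $g$ a polynomial of degree at most $\ell$, where $|r|=\infty$ at the poles of $r$ (after cancellation of common factors), and where only those $r$ compete for which $\sup_{I_1}|r|<\infty$ and $\inf_{I_2}|r|>0$. Then, in the spectral norm, $$\|X-X_\ell\|_2\le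 f(2a)\,(1+\kappa)\,\|F\|_2\cdot\sup_{t\ge0}\max\{\theta_\ell(I_A,I_B-t,\Psi),\ \theta_\ell(I_B,I_A+t,\Xi)\}.$$ -/

import Mathlib

open scoped ComplexOrder ENNReal NNReal Kronecker Polynomial Matrix Matrix.Norms.L2Operator

noncomputable section

/-- `f` is a Cauchy-Stieltjes function: there is a positive measure `μ` on `[0, ∞)` such that
`f z = ∫ 1 / (t + z) dμ(t)` (a convergent integral) for every `z` in `ℂ ∖ (-∞, 0]`. -/
def IsCauchyStieltjes (f : ℂ → ℂ) : Prop :=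
  ∃ μ : MeasureTheory.Measure ℝ≥0, ∀ z ∈ Complex.slitPlane,
    MeasureTheory.Integrable (fun t : ℝ≥0 => 1 / (((t : ℝ) : ℂ) + z)) μ ∧
    f z = ∫ t : ℝ≥0, 1 / (((t : ℝ) : ℂ) + z) ∂μ

/-- The factor `z - ψ` attached to a pole `ψ` of the extended complex plane; it is omitted
(replaced by `1`) if `ψ = ∞`. -/
def poleFactor : OnePoint ℂ → ℂ[X]
  | none => 1
  | some ψ => Polynomial.X - Polynomial.C ψ

/-- The polynomial `∏ (z - ψ_j)` over the finite poles of the tuple `Ψ`. -/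
def polePoly {ℓ : ℕ} (Ψ : Fin ℓ → OnePoint ℂ) : ℂ[X] := ∏ j, poleFactor (Ψ j)

/-- The (block) rational Krylov subspace with poles `Ψ`: the span of the columns of
`q(A)⁻¹ A ^ j v`, `0 ≤ j ≤ ℓ`, where `q = polePoly Ψ`. -/
def rationalKrylov {n s ℓ : ℕ} (A : Matrix (Fin n) (Fin n) ℂ) (v : Matrix (Fin n) (Fin s) ℂ)
    (Ψ : Fin ℓ → OnePoint ℂ) : Submodule ℂ (Fin n → ℂ) :=
  Submodule.span ℂ {w | ∃ j : ℕ, j ≤ ℓ ∧ ∃ i : Fin s,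
    w = ((Polynomial.aeval A (polePoly Ψ))⁻¹ * A ^ j * v).col i}

/-- The columns of `U` form an orthonormal basis of the subspace `S` of `ℂⁿ`. -/
def IsOrthonormalBasisOf {n p : ℕ} (U : Matrix (Fin n) (Fin p) ℂ)
    (S : Submodule ℂ (Fin n → ℂ)) : Prop :=
  Uᴴ * U = 1 ∧ Submodule.span ℂ (Set.range U.col) = S

/-- The inverse of the column-stacking map `Matrix.vec`. -/
def unvec {m n : ℕ} (x : Fin n × Fin m → ℂ) : Matrix (Fin m) (Fin n) ℂ :=
  Matrix.of fun i j => x (j, i)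

/-- The Kronecker sum `I ⊗ A - Bᵀ ⊗ I`. -/
def kroneckerSum {m n : ℕ} (A : Matrix (Fin m) (Fin m) ℂ) (B : Matrix (Fin n) (Fin n) ℂ) :
    Matrix (Fin n × Fin m) (Fin n × Fin m) ℂ :=
  (1 : Matrix (Fin n) (Fin n) ℂ) ⊗ₖ A - Bᵀ ⊗ₖ (1 : Matrix (Fin m) (Fin m) ℂ)

/-- `vec⁻¹ (f(I ⊗ A - Bᵀ ⊗ I) vec F)`; the matrix function is the functional calculus of
normal matrices. -/
def kroneckerFun {m n : ℕ} (f : ℂ → ℂ) (A : Matrix (Fin m) (Fin m) ℂ)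
    (B : Matrix (Fin n) (Fin n) ℂ) (F : Matrix (Fin m) (Fin n) ℂ) : Matrix (Fin m) (Fin n) ℂ :=
  unvec (cfc f (kroneckerSum A B) *ᵥ F.vec)

/-- The projection method: project `A`, `B` and `F = U_F V_Fᵀ` with `U` and `V`, evaluate the
function at the small Kronecker sum, and return `U Y Vᴴ`. -/
def projectedKroneckerFun {n k p q : ℕ} (f : ℂ → ℂ) (A B : Matrix (Fin n) (Fin n) ℂ)
    (U_F V_F : Matrix (Fin n) (Fin k) ℂ) (U : Matrix (Fin n) (Fin p) ℂ)
    (V : Matrix (Fin n) (Fin q) ℂ) : Matrix (Fin n) (Fin n) ℂ :=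
  U * kroneckerFun f (Uᴴ * A * U) (Vᴴ * B * V) ((Uᴴ * U_F) * (V_Fᵀ * V)) * Vᴴ

/-- The set `P_ℓ / Ψ` of rational functions `g / ∏ (z - ψ_j)` with `deg g ≤ ℓ`. -/
def ratFuncsWithPoles {ℓ : ℕ} (Ψ : Fin ℓ → OnePoint ℂ) : Set (RatFunc ℂ) :=
  {r | ∃ g : ℂ[X], g.degree ≤ ℓ ∧
    r = algebraMap ℂ[X] (RatFunc ℂ) g / algebraMap ℂ[X] (RatFunc ℂ) (polePoly Ψ)}

/-- `|r(z)|` in `[0, ∞]`. As `num` and `denom` are coprime, common factors are cancelled, and the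
value is `∞` exactly at the poles of `r`. -/
def ratAbs (r : RatFunc ℂ) (z : ℂ) : ℝ≥0∞ := ‖r.num.eval z‖ₑ / ‖r.denom.eval z‖ₑ

/-- The Zolotarev-type quantity `θ_ℓ(I₁, I₂, Ψ)`: the infimum over `r ∈ P_ℓ / Ψ` of
`max_{I₁} |r| / min_{I₂} |r|`. Functions that are unbounded on `I₁` or not bounded away from
zero on `I₂` (quotient infinite or undefined) do not compete. -/
def zolotarevTheta {ℓ : ℕ} (I₁ I₂ : Set ℂ) (Ψ : Fin ℓ → OnePoint ℂ) : ℝ≥0∞ :=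
  ⨅ (r : RatFunc ℂ) (_ : r ∈ ratFuncsWithPoles Ψ)
    (_ : (⨆ z ∈ I₁, ratAbs r z) ≠ ∞) (_ : (⨅ z ∈ I₂, ratAbs r z) ≠ 0),
    (⨆ z ∈ I₁, ratAbs r z) / (⨅ z ∈ I₂, ratAbs r z)

/-- The real interval `[α, β]` as a subset of `ℂ`. -/
def realInterval (α β : ℝ) : Set ℂ := (fun x : ℝ => (x : ℂ)) '' Set.Icc α β

end

/-! Integrating against `μ` reduces the theorem to resolvents. The matrix with vectorization `(t +
𝓜)⁻¹ vec F` solves the Sylvester equation `A X - X (B - t) = F`, and the projected resolvent is its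
Galerkin solution. A resolvent error of at most `C / (2a + t)` integrates to `C f(2a)`.

For fixed `t`, the Galerkin residual splits into a part orthogonal to the left Krylov space and one
orthogonal to the right space. Spectral separation bounds the Sylvester operator below by `2a + t`
(`Matrix.sylvester_lower_bound`), so it is enough to bound both parts (`l2_opNorm_sub_galerkin_le`).

The left part is `T Y` with `T = (1 - U Uᴴ) A U`. Exactness of rational Krylov spaces makes `T`
annihilate `A_ℓ ^ i W` for small `i`, where `W` comes from `den(A)⁻¹ U_F`. Telescoping sums of such
terms may be added to `Y` without changing `T Y`. For a competitor `r = num / den` they turn the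
right-hand side `C` into `r(A_ℓ) C r(B)⁻¹`, with `B` the projected and shifted coefficient
(`Matrix.l2_opNorm_mul_sylvester_solution_le`). Its norm carries the factor `sup |r| / inf |r|`, and
the infimum over `r` gives `θ_ℓ`. The right part is the left part of the transposed equation. -/

namespace Matrix

/-! ### Spectral norm: transposes, isometries and projections. -/

/-- Entrywise conjugation does not increase the spectral norm. -/
lemma l2_opNorm_map_star_le {m n : Type*} [Fintype m] [Fintype n] [DecidableEq n]
    (M : Matrix m n ℂ) : ‖M.map star‖ ≤ ‖M‖ := by
  rw [l2_opNorm_def]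
  refine ContinuousLinearMap.opNorm_le_bound _ (norm_nonneg _) fun x => ?_
  have h := l2_opNorm_mulVec M (WithLp.toLp 2 (star x.ofLp))
  have h1 : ‖(WithLp.toLp 2 (star x.ofLp) : EuclideanSpace ℂ n)‖ = ‖x‖ := by
    simp [EuclideanSpace.norm_eq]
  have h2 : ‖(WithLp.toLp 2 (M.map star *ᵥ x.ofLp) : EuclideanSpace ℂ m)‖ =
      ‖(WithLp.toLp 2 (M *ᵥ star x.ofLp) : EuclideanSpace ℂ m)‖ := by
    have : M.map star *ᵥ x.ofLp = star (M *ᵥ star x.ofLp) := by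
      ext i
      simp [mulVec, dotProduct]
    rw [this]
    simp [EuclideanSpace.norm_eq]
  rw [h1] at h
  exact h2.trans_le h

lemma l2_opNorm_transpose {m n : Type*} [Fintype m] [Fintype n] [DecidableEq n] [DecidableEq m]
    (M : Matrix m n ℂ) : ‖Mᵀ‖ = ‖M‖ := by
  have key : ∀ {p q : Type _} [Fintype p] [Fintype q] [DecidableEq p] [DecidableEq q]
      (N : Matrix p q ℂ), ‖N.map star‖ = ‖N‖ := fun N =>
    le_antisymm (l2_opNorm_map_star_le N)
      (by simpa [Matrix.map_map, Function.comp_def] using l2_opNorm_map_star_le (N.map star))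
  rw [← l2_opNorm_conjTranspose M, conjTranspose, key Mᵀ]

lemma l2_opNorm_le_one_of_conjTranspose_mul_self {m n : Type*} [Fintype m] [Fintype n]
    [DecidableEq n] [DecidableEq m] {U : Matrix m n ℂ} (hU : Uᴴ * U = 1) : ‖U‖ ≤ 1 := by
  have h := l2_opNorm_conjTranspose_mul_self U
  have h1 : ‖(1 : Matrix n n ℂ)‖ ≤ 1 := by
    rw [← diagonal_one, l2_opNorm_diagonal]
    exact (pi_norm_le_iff_of_nonneg zero_le_one).2 fun i => by simp
  rw [hU] at h
  nlinarith [norm_nonneg U]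

lemma l2_opNorm_le_one_of_projection {n : Type*} [Fintype n] [DecidableEq n] {P : Matrix n n ℂ}
    (h1 : Pᴴ = P) (h2 : P * P = P) : ‖P‖ ≤ 1 := by
  have h := l2_opNorm_conjTranspose_mul_self P
  rw [h1, h2] at h
  nlinarith [norm_nonneg P]

lemma l2_opNorm_one_sub_mul_conjTranspose_le {m n : Type*} [Fintype m] [Fintype n]
    [DecidableEq n] [DecidableEq m] {U : Matrix m n ℂ} (hU : Uᴴ * U = 1) :
    ‖1 - U * Uᴴ‖ ≤ 1 := by
  refine l2_opNorm_le_one_of_projection (by simp) ?_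
  have : U * Uᴴ * (U * Uᴴ) = U * Uᴴ := by
    rw [Matrix.mul_assoc, ← Matrix.mul_assoc Uᴴ, hU, Matrix.one_mul]
  simp [mul_sub, sub_mul, this]

lemma l2_opNorm_mul_le_of_le {l m n : Type*} [Fintype l] [Fintype m] [Fintype n]
    [DecidableEq n] [DecidableEq m] {M : Matrix l m ℂ} {N : Matrix m n ℂ} {c d : ℝ}
    (hM : ‖M‖ ≤ c) (hN : ‖N‖ ≤ d) : ‖M * N‖ ≤ c * d :=
  (l2_opNorm_mul M N).trans
    (mul_le_mul hM hN (norm_nonneg _) ((norm_nonneg _).trans hM))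

/-! ### Loewner intervals, functional calculus and the Sylvester operator. -/

/-- `α ≤ H ≤ β` in the Loewner order. -/
def LoewnerIcc {n : Type*} [DecidableEq n] (H : Matrix n n ℂ) (α β : ℝ) : Prop :=
  (H - (α : ℂ) • (1 : Matrix n n ℂ)).PosSemidef ∧ ((β : ℂ) • (1 : Matrix n n ℂ) - H).PosSemidef

lemma isHermitian_ofReal_smul_one {n : Type*} [DecidableEq n] (α : ℝ) :
    ((α : ℂ) • (1 : Matrix n n ℂ)).IsHermitian := by
  simp [IsHermitian]

namespace LoewnerIcc

variable {n : Type*} [DecidableEq n] {H : Matrix n n ℂ} {α β : ℝ}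

lemma isHermitian (h : LoewnerIcc H α β) : H.IsHermitian := by
  simpa using h.1.isHermitian.add (isHermitian_ofReal_smul_one α)

lemma transpose (h : LoewnerIcc H α β) : LoewnerIcc Hᵀ α β :=
  ⟨by simpa using h.1.transpose, by simpa using h.2.transpose⟩

lemma sub_smul_one (h : LoewnerIcc H α β) (t : ℝ) :
    LoewnerIcc (H - (t : ℂ) • (1 : Matrix n n ℂ)) (α - t) (β - t) := by
  refine ⟨?_, ?_⟩
  · convert! h.1 using 1
    push_cast
    module
  · convert! h.2 using 1
    push_cast
    module

lemma add_smul_one (h : LoewnerIcc H α β) (t : ℝ) :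
    LoewnerIcc (H + (t : ℂ) • (1 : Matrix n n ℂ)) (α + t) (β + t) := by
  simpa [sub_eq_add_neg] using h.sub_smul_one (-t)

lemma neg (h : LoewnerIcc H α β) : LoewnerIcc (-H) (-β) (-α) := by
  refine ⟨?_, ?_⟩
  · convert! h.2 using 1
    push_cast
    module
  · convert! h.1 using 1
    push_cast
    module

end LoewnerIcc

section Loewner

variable {n m : Type*} [Fintype n] [DecidableEq n] [Fintype m] [DecidableEq m]

lemma mem_spectrum_sub_smul_one {H : Matrix n n ℂ} {z w : ℂ} :
    z ∈ spectrum ℂ (H - w • (1 : Matrix n n ℂ)) ↔ w + z ∈ spectrum ℂ H := by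
  rw [spectrum.mem_iff, spectrum.mem_iff, ← Algebra.algebraMap_eq_smul_one, map_add,
    sub_sub_eq_add_sub, add_comm]

lemma mem_spectrum_smul_one_sub {H : Matrix n n ℂ} {z w : ℂ} :
    z ∈ spectrum ℂ (w • (1 : Matrix n n ℂ) - H) ↔ w - z ∈ spectrum ℂ H := by
  rw [spectrum.mem_iff, spectrum.mem_iff, ← Algebra.algebraMap_eq_smul_one, map_sub,
    ← IsUnit.neg_iff, neg_sub, sub_right_comm]

namespace LoewnerIcc

variable {H : Matrix n n ℂ} {α β : ℝ}

lemma isStarNormal (h : LoewnerIcc H α β) : IsStarNormal H :=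
  IsSelfAdjoint.isStarNormal h.isHermitian

lemma of_spectrum (hH : H.IsHermitian) (hs : spectrum ℝ H ⊆ Set.Icc α β) :
    LoewnerIcc H α β := by
  have key : ∀ z ∈ spectrum ℂ H, ∃ x : ℝ, (x : ℂ) = z ∧ α ≤ x ∧ x ≤ β := by
    rw [hH.spectrum_eq_image_range, ← hH.spectrum_real_eq_range_eigenvalues]
    rintro _ ⟨x, hx, rfl⟩
    exact ⟨x, rfl, hs hx⟩
  refine ⟨posSemidef_iff_isHermitian_and_spectrum_nonneg.2
      ⟨hH.sub (isHermitian_ofReal_smul_one α), fun z hz => ?_⟩,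
    posSemidef_iff_isHermitian_and_spectrum_nonneg.2
      ⟨(isHermitian_ofReal_smul_one β).sub hH, fun z hz => ?_⟩⟩
  · obtain ⟨x, hx, h1, -⟩ := key _ (mem_spectrum_sub_smul_one.1 hz)
    have : z = ((x - α : ℝ) : ℂ) := by push_cast; rw [hx]; ring
    simp only [Set.mem_ofPred_eq, this]
    exact_mod_cast sub_nonneg.2 h1
  · obtain ⟨x, hx, -, h1⟩ := key _ (mem_spectrum_smul_one_sub.1 hz)
    have : z = ((β - x : ℝ) : ℂ) := by push_cast; rw [hx]; ring
    simp only [Set.mem_ofPred_eq, this]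
    exact_mod_cast sub_nonneg.2 h1

lemma mem_realInterval (h : LoewnerIcc H α β) {z : ℂ} (hz : z ∈ spectrum ℂ H) :
    z ∈ realInterval α β := by
  have h1 : (0 : ℂ) ≤ z - α := (posSemidef_iff_isHermitian_and_spectrum_nonneg.1 h.1).2
    (mem_spectrum_sub_smul_one.2 (by simpa using hz))
  have h2 : (0 : ℂ) ≤ β - z := (posSemidef_iff_isHermitian_and_spectrum_nonneg.1 h.2).2
    (mem_spectrum_smul_one_sub.2 (by simpa using hz))
  rw [Complex.nonneg_iff] at h1 h2
  simp only [Complex.sub_re, Complex.sub_im, Complex.ofReal_re, Complex.ofReal_im] at h1 h2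
  refine ⟨z.re, ⟨by linarith, by linarith⟩, Complex.ext (by simp) ?_⟩
  simp only [Complex.ofReal_im]
  linarith

/-- Congruence by an isometry preserves positive semidefiniteness. This is why spectral inclusions
are carried as Loewner inequalities: the projected matrices inherit them at once. -/
lemma compress (h : LoewnerIcc H α β) {U : Matrix n m ℂ} (hU : Uᴴ * U = 1) :
    LoewnerIcc (Uᴴ * H * U) α β := by
  have h1 := h.1.conjTranspose_mul_mul_same U
  have h2 := h.2.conjTranspose_mul_mul_same U
  simp only [Matrix.mul_sub, Matrix.sub_mul, Matrix.mul_smul, Matrix.smul_mul, Matrix.mul_one,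
    hU] at h1 h2
  exact ⟨h1, h2⟩

lemma l2_opNorm_cfc_le (h : LoewnerIcc H α β) {f : ℂ → ℂ} {c : ℝ} (hc : 0 ≤ c)
    (hf : ∀ z ∈ realInterval α β, ‖f z‖ ≤ c) : ‖cfc f H‖ ≤ c :=
  norm_cfc_le hc fun z hz => hf z (h.mem_realInterval hz)

lemma l2_opNorm_le (h : LoewnerIcc H α β) {c : ℝ} (hc : 0 ≤ c) (hα : -c ≤ α) (hβ : β ≤ c) :
    ‖H‖ ≤ c := by
  rw [← cfc_id ℂ H h.isStarNormal]
  refine h.l2_opNorm_cfc_le hc ?_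
  rintro _ ⟨x, hx, rfl⟩
  simpa using abs_le.2 ⟨hα.trans hx.1, hx.2.trans hβ⟩

lemma isUnit_aeval (h : LoewnerIcc H α β) {g : ℂ[X]} (hg : ∀ z ∈ realInterval α β, g.eval z ≠ 0) :
    IsUnit (Polynomial.aeval H g) := by
  rw [← cfc_polynomial g H h.isStarNormal,
    isUnit_cfc_iff g.eval H g.continuous.continuousOn h.isStarNormal]
  exact fun z hz => hg z (h.mem_realInterval hz)

/-- The spectral norm of a rational function of a Hermitian matrix is bounded by the supremum
over an interval that contains the spectrum. -/
lemma l2_opNorm_aeval_mul_inv_le (h : LoewnerIcc H α β) {f g : ℂ[X]} {c : ℝ} (hc : 0 ≤ c)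
    (hg : ∀ z ∈ realInterval α β, g.eval z ≠ 0)
    (hfg : ∀ z ∈ realInterval α β, ‖f.eval z‖ / ‖g.eval z‖ ≤ c) :
    ‖Polynomial.aeval H f * (Polynomial.aeval H g)⁻¹‖ ≤ c := by
  have hn := h.isStarNormal
  have hg' : ∀ z ∈ spectrum ℂ H, g.eval z ≠ 0 := fun z hz => hg z (h.mem_realInterval hz)
  have hgi : ContinuousOn (fun z => (g.eval z)⁻¹) (spectrum ℂ H) :=
    g.continuous.continuousOn.inv₀ hg'
  have : Polynomial.aeval H f * (Polynomial.aeval H g)⁻¹ =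
      cfc (fun z => f.eval z * (g.eval z)⁻¹) H := by
    rw [cfc_mul _ _ H f.continuous.continuousOn hgi,
      cfc_inv _ H hg' g.continuous.continuousOn, cfc_polynomial f H, cfc_polynomial g H,
      Matrix.nonsing_inv_eq_ringInverse]
  rw [this]
  refine h.l2_opNorm_cfc_le hc fun z hz => ?_
  rw [norm_mul, norm_inv, ← div_eq_mul_inv]
  exact hfg z hz

end LoewnerIcc

/-- The Sylvester operator `Z ↦ A Z - Z B` is bounded below if `A ≥ a` and `B ≤ b < a`. -/
lemma sylvester_lower_bound {A : Matrix m m ℂ} {B : Matrix n n ℂ} {a a' b b' : ℝ}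
    (hA : LoewnerIcc A a a') (hB : LoewnerIcc B b' b) (Z : Matrix m n ℂ) :
    (a - b) * ‖Z‖ ≤ ‖A * Z - Z * B‖ := by
  -- Adding `c` to both coefficients leaves `A Z - Z B` unchanged. For large `c`, `A + c` is
  -- invertible and `B + c` is positive semidefinite with norm at most `b + c`, so `Z = (A + c)⁻¹
  -- ((A Z - Z B) + Z (B + c))` can be estimated directly.
  obtain ⟨c, hc1, hc2⟩ : ∃ c : ℝ, 0 < a + c ∧ 0 ≤ b' + c ∧ 0 ≤ b + c :=
    ⟨|a| + |b| + |b'| + 1, by linarith [neg_abs_le a, abs_nonneg b, abs_nonneg b'],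
      by linarith [neg_abs_le b', abs_nonneg b, abs_nonneg a],
      by linarith [neg_abs_le b, abs_nonneg a, abs_nonneg b']⟩
  have hAc := hA.add_smul_one c
  have hBn : ‖B + (c : ℂ) • (1 : Matrix n n ℂ)‖ ≤ b + c :=
    (hB.add_smul_one c).l2_opNorm_le hc2.2 (by linarith [hc2.1, hc2.2]) le_rfl
  have h0 : ∀ z ∈ realInterval (a + c) (a' + c), (Polynomial.X : ℂ[X]).eval z ≠ 0 := by
    rintro _ ⟨x, hx, rfl⟩
    simpa using (hc1.trans_le hx.1).ne'
  have hu := hAc.isUnit_aeval h0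
  have hi : ‖(A + (c : ℂ) • (1 : Matrix m m ℂ))⁻¹‖ ≤ (a + c)⁻¹ := by
    simpa using hAc.l2_opNorm_aeval_mul_inv_le (f := 1) (inv_nonneg.2 hc1.le) h0 (by
      rintro _ ⟨x, hx, rfl⟩
      have hx0 := hc1.trans_le hx.1
      simpa [abs_of_pos hx0] using inv_anti₀ hc1 hx.1)
  rw [Polynomial.aeval_X] at hu
  have hZ : Z = (A + (c : ℂ) • (1 : Matrix m m ℂ))⁻¹ *
      ((A * Z - Z * B) + Z * (B + (c : ℂ) • (1 : Matrix n n ℂ))) := by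
    have : (A * Z - Z * B) + Z * (B + (c : ℂ) • (1 : Matrix n n ℂ)) =
        (A + (c : ℂ) • (1 : Matrix m m ℂ)) * Z := by
      simp only [Matrix.mul_add, Matrix.add_mul, Matrix.mul_smul, Matrix.smul_mul,
        Matrix.mul_one, Matrix.one_mul]
      abel
    rw [this, ← Matrix.mul_assoc, nonsing_inv_mul _ ((isUnit_iff_isUnit_det _).1 hu),
      Matrix.one_mul]
  have hle : ‖Z‖ ≤ (a + c)⁻¹ * (‖A * Z - Z * B‖ + ‖Z‖ * (b + c)) := by
    conv_lhs => rw [hZ]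
    exact l2_opNorm_mul_le_of_le hi
      ((norm_add_le _ _).trans (add_le_add_right (l2_opNorm_mul_le_of_le le_rfl hBn) _))
  rw [inv_mul_eq_div, le_div_iff₀ hc1] at hle
  linarith

end Loewner

end Matrix

/-! ### Changing the right-hand side of a Sylvester equation modulo the kernel of `T`. -/

namespace Matrix

section SylvesterReduction

variable {s m n : Type*} [Fintype m] [Fintype n] [DecidableEq m] [DecidableEq n]
  {T : Matrix s m ℂ} {A : Matrix m m ℂ} {B : Matrix n n ℂ} {W : Matrix m n ℂ} {d : ℕ}

/-- The witness is the telescoping sum of `A ^ j W B ^ (i - 1 - j) H` over `j < i`, each term of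
which `T` annihilates. -/
lemma exists_sylvester_eq_pow (hT : ∀ i < d, T * (A ^ i * W) = 0) {i : ℕ} (hi : i ≤ d)
    (H : Matrix n n ℂ) (hH : Commute B H) :
    ∃ N : Matrix m n ℂ, T * N = 0 ∧ A * N - N * B = A ^ i * W * H - W * (B ^ i * H) := by
  induction i generalizing H with
  | zero => exact ⟨0, by simp, by simp⟩
  | succ i ih =>
    obtain ⟨N, hN, hN'⟩ := ih (by lia) (B * H) ((Commute.refl B).mul_right hH)
    refine ⟨N + A ^ i * W * H, ?_, ?_⟩
    · rw [Matrix.mul_add, hN, ← Matrix.mul_assoc, hT i (by lia), Matrix.zero_mul, add_zero]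
    · have h1 : A * (A ^ i * W * H) = A ^ (i + 1) * W * H := by
        rw [pow_succ']
        simp only [Matrix.mul_assoc]
      have h2 : A ^ i * W * H * B = A ^ i * W * (B * H) := by
        rw [Matrix.mul_assoc, hH.eq]
      have h3 : B ^ i * (B * H) = B ^ (i + 1) * H := by
        rw [pow_succ, Matrix.mul_assoc]
      rw [h3] at hN'
      rw [Matrix.mul_add, Matrix.add_mul, h1, h2, add_sub_add_comm, hN']
      abel

lemma exists_sylvester_eq_aeval (hT : ∀ i < d, T * (A ^ i * W) = 0) {f : ℂ[X]}
    (hf : f.natDegree ≤ d) (H : Matrix n n ℂ) (hH : Commute B H) :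
    ∃ N : Matrix m n ℂ, T * N = 0 ∧ A * N - N * B =
      Polynomial.aeval A f * W * H - W * (Polynomial.aeval B f * H) := by
  have h (i : ℕ) : ∃ N : Matrix m n ℂ, i ≤ d → T * N = 0 ∧
      A * N - N * B = A ^ i * W * H - W * (B ^ i * H) := by
    by_cases hi : i ≤ d
    · obtain ⟨N, hN⟩ := exists_sylvester_eq_pow hT hi H hH
      exact ⟨N, fun _ => hN⟩
    · exact ⟨0, fun h => absurd h hi⟩
  choose N hN using h
  have hlt {i : ℕ} (hi : i ∈ Finset.range (d + 1)) : i ≤ d := by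
    simpa [Nat.lt_succ_iff] using hi
  refine ⟨∑ i ∈ Finset.range (d + 1), f.coeff i • N i, ?_, ?_⟩
  · rw [Matrix.mul_sum]
    exact Finset.sum_eq_zero fun i hi => by rw [Matrix.mul_smul, (hN i (hlt hi)).1, smul_zero]
  · rw [Polynomial.aeval_eq_sum_range' (Nat.lt_succ_of_le hf) A,
      Polynomial.aeval_eq_sum_range' (Nat.lt_succ_of_le hf) B]
    simp only [Matrix.mul_sum, Matrix.sum_mul, Matrix.mul_smul, Matrix.smul_mul]
    rw [← Finset.sum_sub_distrib, ← Finset.sum_sub_distrib]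
    exact Finset.sum_congr rfl fun i hi => by
      rw [← smul_sub, ← smul_sub, (hN i (hlt hi)).2]

/-- Up to a matrix annihilated by `T`, the solution of `A Y - Y B = den(A) W` solves the Sylvester
equation with the right-hand side `num(A) W den(B) num(B)⁻¹`. -/
lemma l2_opNorm_mul_sylvester_solution_le [Fintype s] (hT : ∀ i < d, T * (A ^ i * W) = 0)
    {num den : ℂ[X]} (hnum : num.natDegree ≤ d) (hden : den.natDegree ≤ d)
    (hA : IsUnit (Polynomial.aeval A den)) (hB : IsUnit (Polynomial.aeval B num))
    {g : ℝ} (hg : 0 < g) (hgap : ∀ Z : Matrix m n ℂ, g * ‖Z‖ ≤ ‖A * Z - Z * B‖)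
    {Y C : Matrix m n ℂ} (hC : C = Polynomial.aeval A den * W) (hY : A * Y - Y * B = C)
    {c₁ c₂ : ℝ} (h₁ : ‖Polynomial.aeval A num * (Polynomial.aeval A den)⁻¹‖ ≤ c₁)
    (h₂ : ‖Polynomial.aeval B den * (Polynomial.aeval B num)⁻¹‖ ≤ c₂) :
    ‖T * Y‖ ≤ ‖T‖ * ‖C‖ / g * (c₁ * c₂) := by
  have hB' := (isUnit_iff_isUnit_det _).1 hB
  have hA' := (isUnit_iff_isUnit_det _).1 hA
  have hcomm (f : ℂ[X]) : Commute B (Polynomial.aeval B f) := by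
    have := (Polynomial.commute_X f).map (Polynomial.aeval B)
    rwa [Polynomial.aeval_X] at this
  have hcommi : Commute B (Polynomial.aeval B num)⁻¹ := by
    obtain ⟨u, hu⟩ := hB
    rw [← hu, ← coe_units_inv]
    exact Commute.units_inv_right (hu ▸ hcomm num)
  -- `N₁` exchanges `den(A) W` for `W den(B)`. With `H = den(B) num(B)⁻¹`, `N₂` exchanges `num(A) W
  -- H` for the same `W den(B)`, which therefore cancels in the equation for `Y - N₁ + N₂`.
  obtain ⟨N₁, hN₁, hN₁'⟩ := exists_sylvester_eq_aeval hT hden (1 : Matrix n n ℂ)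
    (Commute.one_right B)
  obtain ⟨N₂, hN₂, hN₂'⟩ := exists_sylvester_eq_aeval hT hnum
    (Polynomial.aeval B den * (Polynomial.aeval B num)⁻¹) ((hcomm den).mul_right hcommi)
  have hcancel : Polynomial.aeval B num *
      (Polynomial.aeval B den * (Polynomial.aeval B num)⁻¹) = Polynomial.aeval B den := by
    rw [← Matrix.mul_assoc, ← map_mul, mul_comm num, map_mul, Matrix.mul_assoc,
      mul_nonsing_inv _ hB', Matrix.mul_one]
  have hW : Polynomial.aeval A num * W =
      Polynomial.aeval A num * (Polynomial.aeval A den)⁻¹ * C := by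
    rw [hC, Matrix.mul_assoc, ← Matrix.mul_assoc _ _ W, nonsing_inv_mul _ hA', Matrix.one_mul]
  rw [hcancel, hW] at hN₂'
  rw [Matrix.mul_one, Matrix.mul_one, ← hC] at hN₁'
  have hTZ : T * (Y - N₁ + N₂) = T * Y := by
    rw [Matrix.mul_add, Matrix.mul_sub, hN₁, hN₂, sub_zero, add_zero]
  have hZ : A * (Y - N₁ + N₂) - (Y - N₁ + N₂) * B =
      Polynomial.aeval A num * (Polynomial.aeval A den)⁻¹ * C *
        (Polynomial.aeval B den * (Polynomial.aeval B num)⁻¹) := by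
    calc _ = (A * Y - Y * B) - (A * N₁ - N₁ * B) + (A * N₂ - N₂ * B) := by
          simp only [Matrix.mul_add, Matrix.add_mul, Matrix.mul_sub, Matrix.sub_mul]
          abel
      _ = _ := by
          rw [hY, hN₁', hN₂']
          abel
  have hle : g * ‖Y - N₁ + N₂‖ ≤ c₁ * ‖C‖ * c₂ := by
    refine (hgap _).trans ?_
    rw [hZ]
    exact l2_opNorm_mul_le_of_le (l2_opNorm_mul_le_of_le h₁ le_rfl) h₂
  rw [← hTZ]
  refine (l2_opNorm_mul T _).trans ?_
  have : ‖Y - N₁ + N₂‖ ≤ c₁ * ‖C‖ * c₂ / g := by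
    rw [le_div_iff₀ hg]
    linarith
  refine (mul_le_mul_of_nonneg_left this (norm_nonneg T)).trans_eq ?_
  ring

end SylvesterReduction

end Matrix

/-! ### Pole polynomials, rational Krylov spaces and reduced fractions. -/

lemma polePoly_ne_zero {ℓ : ℕ} (Ψ : Fin ℓ → OnePoint ℂ) : polePoly Ψ ≠ 0 := by
  refine Finset.prod_ne_zero_iff.2 fun j _ => ?_
  rcases Ψ j with _ | ψ
  · exact one_ne_zero
  · exact Polynomial.X_sub_C_ne_zero ψ

lemma natDegree_polePoly_le {ℓ : ℕ} (Ψ : Fin ℓ → OnePoint ℂ) : (polePoly Ψ).natDegree ≤ ℓ := by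
  refine (Polynomial.natDegree_prod_le _ _).trans
    ((Finset.sum_le_card_nsmul _ _ 1 fun j _ => ?_).trans (by simp))
  rcases Ψ j with _ | ψ
  · exact (Polynomial.natDegree_one (R := ℂ)).trans_le zero_le_one
  · exact (Polynomial.natDegree_X_sub_C ψ).le

lemma isUnit_aeval_polePoly {n ℓ : ℕ} {A : Matrix (Fin n) (Fin n) ℂ} {Ψ : Fin ℓ → OnePoint ℂ}
    (hΨ : ∀ (j : Fin ℓ) (z : ℂ), Ψ j = (z : OnePoint ℂ) → z ∉ spectrum ℂ A) :
    IsUnit (Polynomial.aeval A (polePoly Ψ)) := by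
  have h (s : Finset (Fin ℓ)) : IsUnit (Polynomial.aeval A (∏ j ∈ s, poleFactor (Ψ j))) := by
    induction s using Finset.induction_on with
    | empty => simp
    | insert j s hj ih =>
      rw [Finset.prod_insert hj, map_mul]
      refine IsUnit.mul ?_ ih
      have hψ := hΨ j
      generalize Ψ j = x at hψ
      rcases x with _ | ψ
      · simp [poleFactor]
      · rw [← IsUnit.neg_iff]
        simpa [poleFactor] using spectrum.notMem_iff.1 (hψ ψ rfl)
  exact h _

namespace IsOrthonormalBasisOf

variable {n p : ℕ} {U : Matrix (Fin n) (Fin p) ℂ} {S : Submodule ℂ (Fin n → ℂ)}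

lemma mul_conjTranspose_mul (hU : IsOrthonormalBasisOf U S) {s : ℕ}
    {M : Matrix (Fin n) (Fin s) ℂ} (hM : ∀ i, M.col i ∈ S) : U * (Uᴴ * M) = M := by
  have h (i : Fin s) : ∃ x : Fin p → ℂ, U *ᵥ x = M.col i := by
    have := hM i
    rw [← hU.2, ← Matrix.range_mulVecLin] at this
    exact this
  choose x hx using h
  have hMx : M = U * (Matrix.of x)ᵀ := by
    ext i j
    exact (congrFun (hx j) i).symm
  rw [hMx, ← Matrix.mul_assoc Uᴴ, hU.1, Matrix.one_mul]

end IsOrthonormalBasisOf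

lemma col_mem_rationalKrylov {n s ℓ : ℕ} (A : Matrix (Fin n) (Fin n) ℂ)
    (v : Matrix (Fin n) (Fin s) ℂ) (Ψ : Fin ℓ → OnePoint ℂ) {f : ℂ[X]} (hf : f.natDegree ≤ ℓ)
    (i : Fin s) :
    ((Polynomial.aeval A (polePoly Ψ))⁻¹ * Polynomial.aeval A f * v).col i ∈
      rationalKrylov A v Ψ := by
  have : ((Polynomial.aeval A (polePoly Ψ))⁻¹ * Polynomial.aeval A f * v).col i =
      ∑ j ∈ Finset.range (ℓ + 1),
        f.coeff j • ((Polynomial.aeval A (polePoly Ψ))⁻¹ * A ^ j * v).col i := by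
    rw [Polynomial.aeval_eq_sum_range' (Nat.lt_succ_of_le hf) A]
    ext k
    simp [Matrix.mul_sum, Matrix.sum_mul, Matrix.sum_apply]
  rw [this]
  exact Submodule.sum_mem _ fun j hj => Submodule.smul_mem _ _
    (Submodule.subset_span ⟨j, by simpa [Nat.lt_succ_iff] using hj, i, rfl⟩)

/-- Here `c` is the part of the pole polynomial that cancels. Keeping it separate matters: a
cancelled pole may lie in the interval for `A`, where only the reduced denominator is known not to
vanish. -/
lemma exists_num_denom_of_mem_ratFuncsWithPoles {ℓ : ℕ} {Ψ : Fin ℓ → OnePoint ℂ} {r : RatFunc ℂ}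
    (hr : r ∈ ratFuncsWithPoles Ψ) :
    ∃ c : ℂ[X], polePoly Ψ = r.denom * c ∧ r.num.natDegree + c.natDegree ≤ ℓ ∧
      r.denom.natDegree + c.natDegree ≤ ℓ := by
  obtain ⟨g, hg, hgr⟩ := hr
  have hq := polePoly_ne_zero Ψ
  obtain ⟨c, hc⟩ : r.denom ∣ polePoly Ψ := hgr ▸ RatFunc.denom_div_dvd g (polePoly Ψ)
  have hc0 : c ≠ 0 := fun h => hq (by rw [hc, h, mul_zero])
  have hdeg := natDegree_polePoly_le Ψ
  rw [hc, Polynomial.natDegree_mul r.denom_ne_zero hc0] at hdeg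
  refine ⟨c, hc, ?_, hdeg⟩
  by_cases hn : r.num = 0
  · rw [hn, Polynomial.natDegree_zero]
    lia
  · have hgc : g = r.num * c := by
      have h1 : algebraMap ℂ[X] (RatFunc ℂ) r.denom ≠ 0 :=
        RatFunc.algebraMap_ne_zero r.denom_ne_zero
      have h2 : algebraMap ℂ[X] (RatFunc ℂ) (polePoly Ψ) ≠ 0 := RatFunc.algebraMap_ne_zero hq
      rw [← RatFunc.num_div_denom r, div_eq_div_iff h1 h2, ← map_mul, ← map_mul] at hgr
      have h3 := RatFunc.algebraMap_injective ℂ hgr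
      rw [hc] at h3
      exact mul_right_cancel₀ r.denom_ne_zero (by linear_combination -h3)
    rw [← Polynomial.natDegree_mul hn hc0, ← hgc]
    exact Polynomial.natDegree_le_of_degree_le hg

/-! ### Exactness of rational Krylov spaces and the Galerkin residual. -/

section RationalKrylov

variable {n s p ℓ : ℕ} {A : Matrix (Fin n) (Fin n) ℂ} {v : Matrix (Fin n) (Fin s) ℂ}
  {Ψ : Fin ℓ → OnePoint ℂ} {U : Matrix (Fin n) (Fin p) ℂ}

/-- The starting block lies in the space, since `v = q(A)⁻¹ q(A) v` and `deg q ≤ ℓ`. -/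
lemma IsOrthonormalBasisOf.mul_conjTranspose_mul_rationalKrylov
    (hU : IsOrthonormalBasisOf U (rationalKrylov A v Ψ))
    (hq : IsUnit (Polynomial.aeval A (polePoly Ψ))) : U * (Uᴴ * v) = v := by
  refine hU.mul_conjTranspose_mul fun i => ?_
  have := col_mem_rationalKrylov A v Ψ (natDegree_polePoly_le Ψ) i
  rwa [Matrix.nonsing_inv_mul _ ((Matrix.isUnit_iff_isUnit_det _).1 hq), Matrix.one_mul] at this

/-- The exactness property of rational Krylov spaces, for the starting vectors `den(A)⁻¹ v`. -/
lemma IsOrthonormalBasisOf.pow_mul_denom_inv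
    (hU : IsOrthonormalBasisOf U (rationalKrylov A v Ψ))
    (hq : IsUnit (Polynomial.aeval A (polePoly Ψ))) {den c : ℂ[X]} (hc : polePoly Ψ = den * c)
    {i : ℕ} (hi : i + c.natDegree ≤ ℓ) :
    U * ((Uᴴ * A * U) ^ i * (Uᴴ * ((Polynomial.aeval A den)⁻¹ * v))) =
      A ^ i * ((Polynomial.aeval A den)⁻¹ * v) := by
  have hdet := (Matrix.isUnit_iff_isUnit_det _).1 hq
  have hden : IsUnit (Polynomial.aeval A den).det := by
    rw [hc, map_mul, Matrix.det_mul] at hdet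
    exact isUnit_of_mul_isUnit_left hdet
  -- With `q = den * c`, `A ^ j den(A)⁻¹ v = q(A)⁻¹ c(A) A ^ j v`, which lies in the Krylov space as
  -- long as `j + deg c ≤ ℓ`.
  have hmem (j : ℕ) (hj : j + c.natDegree ≤ ℓ) :
      U * (Uᴴ * (A ^ j * ((Polynomial.aeval A den)⁻¹ * v))) =
        A ^ j * ((Polynomial.aeval A den)⁻¹ * v) := by
    refine hU.mul_conjTranspose_mul fun k => ?_
    have hdeg : (c * Polynomial.X ^ j).natDegree ≤ ℓ :=
      Polynomial.natDegree_mul_le.trans (by rw [Polynomial.natDegree_X_pow]; lia)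
    have hm := col_mem_rationalKrylov A v Ψ hdeg k
    have he : (Polynomial.aeval A (polePoly Ψ))⁻¹ * Polynomial.aeval A (c * Polynomial.X ^ j) =
        A ^ j * (Polynomial.aeval A den)⁻¹ := by
      have h1 : Polynomial.aeval A (c * Polynomial.X ^ j) * Polynomial.aeval A den =
          Polynomial.aeval A (polePoly Ψ) * A ^ j := by
        rw [← map_mul, show c * Polynomial.X ^ j * den = polePoly Ψ * Polynomial.X ^ j by
          rw [hc]; ring, map_mul, map_pow, Polynomial.aeval_X]
      calc _ = (Polynomial.aeval A (polePoly Ψ))⁻¹ * (Polynomial.aeval A (c * Polynomial.X ^ j) *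
            Polynomial.aeval A den) * (Polynomial.aeval A den)⁻¹ := by
            rw [Matrix.mul_assoc, Matrix.mul_assoc, Matrix.mul_nonsing_inv _ hden, Matrix.mul_one]
        _ = _ := by
            rw [h1, ← Matrix.mul_assoc, Matrix.nonsing_inv_mul _ hdet, Matrix.one_mul]
    rwa [he, Matrix.mul_assoc] at hm
  induction i with
  | zero => simpa using hmem 0 (by lia)
  | succ i ih =>
    have h1 : (Uᴴ * A * U) ^ (i + 1) * (Uᴴ * ((Polynomial.aeval A den)⁻¹ * v)) =
        Uᴴ * (A * (U * ((Uᴴ * A * U) ^ i * (Uᴴ * ((Polynomial.aeval A den)⁻¹ * v))))) := by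
      rw [pow_succ']
      simp only [Matrix.mul_assoc]
    rw [h1, ih (by lia), ← Matrix.mul_assoc A, ← pow_succ', hmem _ hi]

/-- At a zero of the denominator, coprimality keeps the numerator nonzero, which excludes the
convention `0 / 0 = 0`. -/
lemma ratAbs_ne_top_iff {r : RatFunc ℂ} {z : ℂ} : ratAbs r z ≠ ∞ ↔ r.denom.eval z ≠ 0 := by
  unfold ratAbs
  refine ⟨fun h hd => h ?_, fun h => ENNReal.div_ne_top (by simp) (by simpa using h)⟩
  obtain ⟨a, b, hab⟩ := r.isCoprime_num_denom
  have hn : r.num.eval z ≠ 0 := fun hn => by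
    simpa [hd, hn] using congrArg (Polynomial.eval z) hab
  rw [hd, enorm_zero, ENNReal.div_zero (by simpa using hn)]

lemma ratAbs_toReal (r : RatFunc ℂ) (z : ℂ) :
    (ratAbs r z).toReal = ‖r.num.eval z‖ / ‖r.denom.eval z‖ := by
  simp [ratAbs, ENNReal.toReal_div]

/-- The component of a Galerkin residual that is orthogonal to a rational Krylov space,
estimated with the help of one rational function. -/
lemma l2_opNorm_residual_le_of_mem_ratFuncsWithPoles {q : ℕ} {B : Matrix (Fin q) (Fin q) ℂ}
    (hU : IsOrthonormalBasisOf U (rationalKrylov A v Ψ))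
    (hq : IsUnit (Polynomial.aeval A (polePoly Ψ)))
    {α β γ δ : ℝ} (hA : (Uᴴ * A * U).LoewnerIcc α β) (hB : B.LoewnerIcc γ δ)
    {g : ℝ} (hg : 0 < g)
    (hgap : ∀ Z : Matrix (Fin p) (Fin q) ℂ, g * ‖Z‖ ≤ ‖Uᴴ * A * U * Z - Z * B‖)
    {Y : Matrix (Fin p) (Fin q) ℂ} {E : Matrix (Fin s) (Fin q) ℂ}
    (hY : Uᴴ * A * U * Y - Y * B = Uᴴ * (v * E))
    {r : RatFunc ℂ} (hr : r ∈ ratFuncsWithPoles Ψ)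
    (hsup : (⨆ z ∈ realInterval α β, ratAbs r z) ≠ ∞)
    (hinf : (⨅ z ∈ realInterval γ δ, ratAbs r z) ≠ 0) :
    ‖(1 - U * Uᴴ) * A * U * Y‖ ≤ ‖(1 - U * Uᴴ) * A * U‖ * ‖Uᴴ * (v * E)‖ / g *
      ((⨆ z ∈ realInterval α β, ratAbs r z) / ⨅ z ∈ realInterval γ δ, ratAbs r z).toReal := by
  obtain ⟨c, hc, hnum, hden⟩ := exists_num_denom_of_mem_ratFuncsWithPoles hr
  have hdetA : IsUnit (Polynomial.aeval A r.denom).det := by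
    have hdet := (Matrix.isUnit_iff_isUnit_det _).1 hq
    rw [hc, map_mul, Matrix.det_mul] at hdet
    exact isUnit_of_mul_isUnit_left hdet
  have hle {z : ℂ} (hz : z ∈ realInterval α β) :
      ratAbs r z ≤ ⨆ z ∈ realInterval α β, ratAbs r z := le_iSup₂_of_le z hz le_rfl
  have hge {z : ℂ} (hz : z ∈ realInterval γ δ) :
      ⨅ z ∈ realInterval γ δ, ratAbs r z ≤ ratAbs r z := iInf₂_le z hz
  have hd : ∀ z ∈ realInterval α β, r.denom.eval z ≠ 0 := fun z hz =>
    ratAbs_ne_top_iff.1 (ne_top_of_le_ne_top hsup (hle hz))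
  have hn : ∀ z ∈ realInterval γ δ, r.num.eval z ≠ 0 := fun z hz h0 =>
    hinf (le_antisymm ((hge hz).trans_eq (by simp [ratAbs, h0])) zero_le)
  have h₁ := hA.l2_opNorm_aeval_mul_inv_le (f := r.num) ENNReal.toReal_nonneg hd fun z hz => by
    rw [← ratAbs_toReal]
    exact ENNReal.toReal_mono hsup (hle hz)
  -- Poles of `r` in this second interval are harmless: only `1 / r = den / num` is evaluated there,
  -- and it vanishes at them.
  have h₂ := hB.l2_opNorm_aeval_mul_inv_le (f := r.denom)
    (c := (⨅ z ∈ realInterval γ δ, ratAbs r z)⁻¹.toReal) ENNReal.toReal_nonneg hn fun z hz => by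
    rw [← inv_div, ← ratAbs_toReal, ← ENNReal.toReal_inv]
    exact ENNReal.toReal_mono (ENNReal.inv_ne_top.2 hinf) (ENNReal.inv_le_inv.2 (hge hz))
  rw [div_eq_mul_inv (⨆ z ∈ _, _), ENNReal.toReal_mul]
  have hpow {i : ℕ} (hi : i + c.natDegree ≤ ℓ) := hU.pow_mul_denom_inv hq hc hi
  have hcE (M : Matrix (Fin p) (Fin p) ℂ) :
      M * (Uᴴ * ((Polynomial.aeval A r.denom)⁻¹ * v) * E) =
        M * (Uᴴ * ((Polynomial.aeval A r.denom)⁻¹ * v)) * E := by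
    simp only [Matrix.mul_assoc]
  refine Matrix.l2_opNorm_mul_sylvester_solution_le (d := ℓ - c.natDegree)
    (W := Uᴴ * ((Polynomial.aeval A r.denom)⁻¹ * v) * E) (fun i hi => ?_) (by lia) (by lia)
    (hA.isUnit_aeval hd) (hB.isUnit_aeval hn) hg hgap ?_ hY h₁ h₂
  -- The bound `i < d` is strict because `T` contains one more factor `A`: exactness is needed at
  -- both `i` and `i + 1`.
  · have h1 : U * ((Uᴴ * A * U) ^ (i + 1) * (Uᴴ * ((Polynomial.aeval A r.denom)⁻¹ * v))) =
        U * Uᴴ * A * (U * ((Uᴴ * A * U) ^ i * (Uᴴ * ((Polynomial.aeval A r.denom)⁻¹ * v)))) := by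
      rw [pow_succ']
      simp only [Matrix.mul_assoc]
    rw [hpow (by lia), hpow (by lia), pow_succ', Matrix.mul_assoc A] at h1
    rw [hcE, ← Matrix.mul_assoc, Matrix.mul_assoc _ U, hpow (by lia), Matrix.sub_mul,
      Matrix.one_mul, Matrix.sub_mul, ← h1, sub_self, Matrix.zero_mul]
  · have hex (w : Matrix (Fin n) (Fin s) ℂ) (hw : ∀ i, i + c.natDegree ≤ ℓ →
        U * ((Uᴴ * A * U) ^ i * (Uᴴ * w)) = A ^ i * w) :
        Polynomial.aeval (Uᴴ * A * U) r.denom * (Uᴴ * w) =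
          Uᴴ * (Polynomial.aeval A r.denom * w) := by
      rw [Polynomial.aeval_eq_sum_range, Polynomial.aeval_eq_sum_range]
      simp only [Matrix.sum_mul, Matrix.mul_sum, Matrix.smul_mul, Matrix.mul_smul]
      refine Finset.sum_congr rfl fun i hi => ?_
      rw [← hw i (by have := Finset.mem_range.1 hi; lia), ← Matrix.mul_assoc Uᴴ U, hU.1,
        Matrix.one_mul]
    rw [hcE, hex _ fun i hi => hpow hi, ← Matrix.mul_assoc _ _ v, Matrix.mul_nonsing_inv _ hdetA,
      Matrix.one_mul,
      Matrix.mul_assoc]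

/-- The component of a Galerkin residual that is orthogonal to a rational Krylov space. -/
lemma l2_opNorm_residual_le {q : ℕ} {B : Matrix (Fin q) (Fin q) ℂ}
    (hU : IsOrthonormalBasisOf U (rationalKrylov A v Ψ))
    (hq : IsUnit (Polynomial.aeval A (polePoly Ψ)))
    {α β γ δ : ℝ} (hA : (Uᴴ * A * U).LoewnerIcc α β) (hB : B.LoewnerIcc γ δ)
    {g : ℝ} (hg : 0 < g)
    (hgap : ∀ Z : Matrix (Fin p) (Fin q) ℂ, g * ‖Z‖ ≤ ‖Uᴴ * A * U * Z - Z * B‖)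
    {Y : Matrix (Fin p) (Fin q) ℂ} {E : Matrix (Fin s) (Fin q) ℂ}
    (hY : Uᴴ * A * U * Y - Y * B = Uᴴ * (v * E)) {c θ : ℝ} (hc : ‖A‖ ≤ c) (hθ : 0 ≤ θ)
    (hle : zolotarevTheta (realInterval α β) (realInterval γ δ) Ψ ≤ ENNReal.ofReal θ) :
    ‖(1 - U * Uᴴ) * A * U * Y‖ ≤ c * ‖v * E‖ / g * θ := by
  have hD : ‖(1 - U * Uᴴ) * A * U‖ * ‖Uᴴ * (v * E)‖ / g ≤ c * ‖v * E‖ / g := by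
    have h1 := Matrix.l2_opNorm_le_one_of_conjTranspose_mul_self hU.1
    have h2 : ‖(1 - U * Uᴴ) * A * U‖ ≤ 1 * c * 1 :=
      Matrix.l2_opNorm_mul_le_of_le (Matrix.l2_opNorm_mul_le_of_le
        (Matrix.l2_opNorm_one_sub_mul_conjTranspose_le hU.1) hc) h1
    have h3 : ‖Uᴴ * (v * E)‖ ≤ 1 * ‖v * E‖ :=
      Matrix.l2_opNorm_mul_le_of_le ((Matrix.l2_opNorm_conjTranspose U).trans_le h1) le_rfl
    rw [one_mul] at h3
    rw [one_mul, mul_one] at h2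
    gcongr
    exact (norm_nonneg A).trans hc
  refine le_trans ?_ (mul_le_mul_of_nonneg_right hD hθ)
  have hD0 : 0 ≤ ‖(1 - U * Uᴴ) * A * U‖ * ‖Uᴴ * (v * E)‖ / g := by positivity
  -- The infimum defining `θ_ℓ` need not be attained, so a competitor within `ε` is used and `ε`
  -- tends to `0`.
  have key : ∀ ε > 0, ‖(1 - U * Uᴴ) * A * U * Y‖ ≤
      ‖(1 - U * Uᴴ) * A * U‖ * ‖Uᴴ * (v * E)‖ / g * (θ + ε) := fun ε hε => by
    have hlt : zolotarevTheta (realInterval α β) (realInterval γ δ) Ψ < ENNReal.ofReal (θ + ε) :=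
      hle.trans_lt ((ENNReal.ofReal_lt_ofReal_iff (by linarith)).2 (by linarith))
    simp only [zolotarevTheta, iInf_lt_iff] at hlt
    obtain ⟨r, hr, hsup, hinf, hlt⟩ := hlt
    refine (l2_opNorm_residual_le_of_mem_ratFuncsWithPoles hU hq hA hB hg hgap hY hr hsup
      hinf).trans (mul_le_mul_of_nonneg_left ?_ hD0)
    exact ENNReal.toReal_le_of_le_ofReal (by linarith) hlt.le
  have hlim : Filter.Tendsto (fun ε : ℝ =>
      ‖(1 - U * Uᴴ) * A * U‖ * ‖Uᴴ * (v * E)‖ / g * (θ + ε)) (nhdsWithin 0 (Set.Ioi 0))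
      (nhds (‖(1 - U * Uᴴ) * A * U‖ * ‖Uᴴ * (v * E)‖ / g * (θ + 0))) :=
    Filter.Tendsto.mono_left (Continuous.tendsto (by fun_prop) 0) nhdsWithin_le_nhds
  rw [add_zero] at hlim
  exact ge_of_tendsto hlim (eventually_nhdsWithin_of_forall fun ε hε => key ε hε)

end RationalKrylov

/-! ### Galerkin error for one shifted Sylvester equation. -/

section GalerkinError

variable {n k p q ℓ : ℕ} {A B : Matrix (Fin n) (Fin n) ℂ} {U_F V_F : Matrix (Fin n) (Fin k) ℂ}
  {Ψ Ξ : Fin ℓ → OnePoint ℂ} {U : Matrix (Fin n) (Fin p) ℂ} {V : Matrix (Fin n) (Fin q) ℂ}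

lemma conjTranspose_mul_self_of_map_star (hV : (V.map star)ᴴ * V.map star = 1) : Vᴴ * V = 1 := by
  have h := congrArg Matrix.transpose hV
  have hV' : (V.map star)ᴴᵀ = V := by
    ext i j
    simp
  rw [Matrix.transpose_mul, Matrix.transpose_one, hV'] at h
  exact h

/-- The error of the Galerkin approximation of the solution of a Sylvester equation. -/
lemma l2_opNorm_sub_galerkin_le {a b t : ℝ} (ha : 0 < a) (hb : 0 ≤ b) (ht : 0 ≤ t)
    (hAb : A.LoewnerIcc a b) (hBb : B.LoewnerIcc (-b) (-a)) {α β γ δ : ℝ}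
    (hA : A.LoewnerIcc α β) (hB : B.LoewnerIcc γ δ)
    (hΨ : IsUnit (Polynomial.aeval A (polePoly Ψ)))
    (hΞ : IsUnit (Polynomial.aeval Bᵀ (polePoly Ξ)))
    (hU : IsOrthonormalBasisOf U (rationalKrylov A U_F Ψ))
    (hV : IsOrthonormalBasisOf (V.map star) (rationalKrylov Bᵀ V_F Ξ))
    {X : Matrix (Fin n) (Fin n) ℂ} {Y : Matrix (Fin p) (Fin q) ℂ}
    (hX : A * X - X * (B - (t : ℂ) • (1 : Matrix (Fin n) (Fin n) ℂ)) = U_F * V_Fᵀ)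
    (hY : Uᴴ * A * U * Y - Y * (Vᴴ * B * V - (t : ℂ) • (1 : Matrix (Fin q) (Fin q) ℂ)) =
      (Uᴴ * U_F) * (V_Fᵀ * V)) {θ : ℝ} (hθ : 0 ≤ θ)
    (hθ₁ : zolotarevTheta (realInterval α β) (realInterval (γ - t) (δ - t)) Ψ ≤ ENNReal.ofReal θ)
    (hθ₂ : zolotarevTheta (realInterval γ δ) (realInterval (α + t) (β + t)) Ξ ≤
      ENNReal.ofReal θ) :
    ‖X - U * Y * Vᴴ‖ ≤ (1 + b / a) * ‖U_F * V_Fᵀ‖ * θ / (2 * a + t) := by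
  have hg : 0 < 2 * a + t := by linarith
  have hVV := conjTranspose_mul_self_of_map_star hV.1
  have hUn := Matrix.l2_opNorm_le_one_of_conjTranspose_mul_self hU.1
  have hVn := Matrix.l2_opNorm_le_one_of_conjTranspose_mul_self hVV
  have hVhn : ‖Vᴴ‖ ≤ 1 := (Matrix.l2_opNorm_conjTranspose V).trans_le hVn
  have hAl := hA.compress hU.1
  have hBl := hB.compress hVV
  have hAlb := hAb.compress hU.1
  have hBlb := hBb.compress hVV
  have hAn : ‖A‖ ≤ b := hAb.l2_opNorm_le hb (by linarith) le_rfl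
  have hBn : ‖Bᵀ‖ ≤ b :=
    (Matrix.l2_opNorm_transpose B).trans_le (hBb.l2_opNorm_le hb le_rfl (by linarith))
  have hVs : (V.map star)ᴴ = Vᵀ := by
    ext i j
    simp
  have hVst : (V.map star)ᵀ = Vᴴ := rfl
  have hr₁ : ‖(1 - U * Uᴴ) * A * U * Y‖ ≤ b * ‖U_F * V_Fᵀ‖ / (2 * a + t) * θ := by
    refine (l2_opNorm_residual_le (E := V_Fᵀ * V) hU hΨ hAl (hBl.sub_smul_one t) hg (fun Z => ?_)
      (by rw [hY, Matrix.mul_assoc]) hAn hθ hθ₁).trans ?_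
    · refine le_trans (le_of_eq ?_)
        (Matrix.sylvester_lower_bound hAlb (hBlb.sub_smul_one t) Z)
      ring
    · have : ‖U_F * (V_Fᵀ * V)‖ ≤ ‖U_F * V_Fᵀ‖ * 1 := by
        rw [← Matrix.mul_assoc]
        exact Matrix.l2_opNorm_mul_le_of_le le_rfl hVn
      rw [mul_one] at this
      gcongr
  -- Transposing the projected equation exchanges the roles of the two coefficients: `-Yᵀ` solves
  -- the equation with coefficients `B_ℓᵀ` and `A_ℓᵀ + t`. The shift thus moves to the interval for
  -- `A`.
  have hr₂ : ‖Y * Vᴴ * B * (1 - V * Vᴴ)‖ ≤ b * ‖U_F * V_Fᵀ‖ / (2 * a + t) * θ := by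
    have hBt : (V.map star)ᴴ * Bᵀ * V.map star = (Vᴴ * B * V)ᵀ := by
      rw [hVs, Matrix.transpose_mul, Matrix.transpose_mul, ← Matrix.mul_assoc]
      rfl
    have h := l2_opNorm_residual_le (E := U_Fᵀ * U.map star) (Y := -Yᵀ) hV hΞ
      (by rw [hBt]; exact hBl.transpose) (hAl.transpose.add_smul_one t) hg (fun Z => ?_)
      ?_ hBn hθ hθ₂
    · have h1 : (1 - V.map star * (V.map star)ᴴ) * Bᵀ * V.map star * -Yᵀ =
          (-(Y * Vᴴ * B * (1 - V * Vᴴ)))ᵀ := by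
        rw [hVs]
        simp only [Matrix.transpose_neg, Matrix.transpose_mul, Matrix.transpose_sub,
          Matrix.transpose_one, Matrix.mul_assoc, Matrix.mul_neg]
        rfl
      rw [h1, Matrix.l2_opNorm_transpose, norm_neg] at h
      refine h.trans ?_
      have : ‖V_F * (U_Fᵀ * U.map star)‖ ≤ ‖U_F * V_Fᵀ‖ * 1 := by
        rw [← Matrix.mul_assoc, ← Matrix.l2_opNorm_transpose (U_F * V_Fᵀ), Matrix.transpose_mul,
          Matrix.transpose_transpose]
        exact Matrix.l2_opNorm_mul_le_of_le le_rfl ((Matrix.l2_opNorm_map_star_le U).trans hUn)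
      rw [mul_one] at this
      gcongr
    · rw [hBt]
      -- Now the left coefficient has the lower spectrum; negating both restores the order required
      -- by the lower bound.
      refine le_trans (le_of_eq ?_) ((Matrix.sylvester_lower_bound hBlb.transpose.neg
        (hAlb.transpose.add_smul_one t).neg Z).trans_eq ?_)
      · ring
      · rw [← norm_neg]
        congr 1
        simp only [Matrix.neg_mul, Matrix.mul_neg]
        abel
    · have hYt := congrArg Matrix.transpose hY
      rw [hBt, hVs]
      simp only [Matrix.transpose_sub, Matrix.transpose_mul, Matrix.transpose_smul,
        Matrix.transpose_one, Matrix.transpose_transpose, Matrix.sub_mul, Matrix.smul_mul,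
        Matrix.one_mul] at hYt
      simp only [Matrix.transpose_mul, Matrix.neg_mul, Matrix.mul_neg, Matrix.mul_add,
        Matrix.mul_smul, Matrix.mul_one, smul_neg]
      calc _ = Vᵀ * V_F * (U_Fᵀ * Uᴴᵀ) := by
            rw [← hYt]
            abel
        _ = _ := by
            simp only [Matrix.mul_assoc]
            rfl
  -- Both starting blocks lie in their Krylov spaces, so projection loses nothing of `F` and the
  -- residual consists of the two orthogonal parts only.
  have hF : U_F * V_Fᵀ = U * (Uᴴ * U_F * (V_Fᵀ * V)) * Vᴴ := by
    have h1 := hU.mul_conjTranspose_mul_rationalKrylov hΨ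
    have h2 := congrArg Matrix.transpose (hV.mul_conjTranspose_mul_rationalKrylov hΞ)
    rw [hVs, Matrix.transpose_mul, Matrix.transpose_mul, Matrix.transpose_transpose, hVst] at h2
    calc _ = (U * (Uᴴ * U_F)) * (V_Fᵀ * V * Vᴴ) := by rw [h1, h2]
      _ = _ := by simp only [Matrix.mul_assoc]
  have hres : A * (X - U * Y * Vᴴ) - (X - U * Y * Vᴴ) *
      (B - (t : ℂ) • (1 : Matrix (Fin n) (Fin n) ℂ)) =
      U * (Y * Vᴴ * B * (1 - V * Vᴴ)) - (1 - U * Uᴴ) * A * U * Y * Vᴴ := by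
    have h1 : A * (X - U * Y * Vᴴ) - (X - U * Y * Vᴴ) *
        (B - (t : ℂ) • (1 : Matrix (Fin n) (Fin n) ℂ)) =
        (A * X - X * (B - (t : ℂ) • (1 : Matrix (Fin n) (Fin n) ℂ))) - (A * (U * Y * Vᴴ) -
          U * Y * Vᴴ * (B - (t : ℂ) • (1 : Matrix (Fin n) (Fin n) ℂ))) := by
      simp only [Matrix.mul_sub, Matrix.sub_mul]
      abel
    rw [h1, hX, hF, ← hY]
    simp only [Matrix.mul_sub, Matrix.sub_mul, Matrix.mul_smul, Matrix.smul_mul, Matrix.mul_one,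
      Matrix.one_mul, Matrix.mul_assoc]
    abel
  have hle := Matrix.sylvester_lower_bound hAb (hBb.sub_smul_one t) (X - U * Y * Vᴴ)
  rw [hres] at hle
  have h₁ := Matrix.l2_opNorm_mul_le_of_le hr₁ hVhn
  have h₂ := Matrix.l2_opNorm_mul_le_of_le hUn hr₂
  -- Each residual part is at most `b ‖F‖ θ / (2a + t)`. Inverting the Sylvester operator
  -- contributes another `1 / (2a + t)`. One of these two factors is spent on `2b / (2a + t) ≤ b / a
  -- ≤ 1 + b / a`; the other is kept for the integration over `t`.
  rw [le_div_iff₀ hg]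
  calc ‖X - U * Y * Vᴴ‖ * (2 * a + t) = (a - (-a - t)) * ‖X - U * Y * Vᴴ‖ := by ring
    _ ≤ _ := hle.trans ((norm_sub_le _ _).trans (add_le_add h₂ h₁))
    _ = 2 * b / (2 * a + t) * (‖U_F * V_Fᵀ‖ * θ) := by ring
    _ ≤ (1 + b / a) * (‖U_F * V_Fᵀ‖ * θ) := by
        refine mul_le_mul_of_nonneg_right ?_ (by positivity)
        calc 2 * b / (2 * a + t) ≤ 2 * b / (2 * a) := by gcongr; linarith
          _ = b / a := mul_div_mul_left _ _ two_ne_zero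
          _ ≤ 1 + b / a := by linarith
    _ = _ := by ring

end GalerkinError

/-! ### Kronecker sums, resolvents and integration against the Stieltjes measure. -/

section CauchyStieltjes

open MeasureTheory

section KroneckerFun

variable {m n : ℕ} {A : Matrix (Fin m) (Fin m) ℂ} {B : Matrix (Fin n) (Fin n) ℂ}

lemma Matrix.LoewnerIcc.kroneckerSum {α β γ δ : ℝ} (hA : A.LoewnerIcc α β)
    (hB : B.LoewnerIcc γ δ) : (kroneckerSum A B).LoewnerIcc (α - δ) (β - γ) := by
  unfold _root_.kroneckerSum
  have h1 := (Matrix.PosSemidef.one (n := Fin n) (R := ℂ)).kronecker hA.1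
  have h2 := (Matrix.PosSemidef.one (n := Fin n) (R := ℂ)).kronecker hA.2
  have h3 := hB.1.transpose.kronecker (Matrix.PosSemidef.one (n := Fin m) (R := ℂ))
  have h4 := hB.2.transpose.kronecker (Matrix.PosSemidef.one (n := Fin m) (R := ℂ))
  simp only [sub_eq_add_neg, Matrix.transpose_add, Matrix.transpose_smul, Matrix.transpose_one,
    Matrix.kronecker_add, Matrix.add_kronecker, Matrix.kronecker_smul,
    Matrix.smul_kronecker, Matrix.one_kronecker_one, ← neg_one_smul ℂ (_ : Matrix _ _ ℂ)]
    at h1 h2 h3 h4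
  refine ⟨?_, ?_⟩
  · convert! h1.add h4 using 1
    push_cast
    module
  · convert! h2.add h3 using 1
    push_cast
    module

lemma kroneckerSum_mulVec_vec (X : Matrix (Fin m) (Fin n) ℂ) :
    kroneckerSum A B *ᵥ X.vec = (A * X - X * B).vec := by
  rw [kroneckerSum, Matrix.sub_mulVec, Matrix.kronecker_mulVec_vec, Matrix.kronecker_mulVec_vec]
  simp

lemma vec_unvec (x : Fin n × Fin m → ℂ) : (unvec x).vec = x := rfl

/-- The matrix `vec⁻¹ ((t + I ⊗ A - Bᵀ ⊗ I)⁻¹ vec F)` solves a shifted Sylvester equation. -/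
lemma kroneckerFun_resolvent {α β γ δ : ℝ} (hA : A.LoewnerIcc α β) (hB : B.LoewnerIcc γ δ)
    (h : δ < α) (F : Matrix (Fin m) (Fin n) ℂ) {t : ℝ} (ht : 0 ≤ t) :
    A * kroneckerFun (fun z => 1 / ((t : ℂ) + z)) A B F -
      kroneckerFun (fun z => 1 / ((t : ℂ) + z)) A B F *
        (B - (t : ℂ) • (1 : Matrix (Fin n) (Fin n) ℂ)) = F := by
  have hM := hA.kroneckerSum hB
  have hn := hM.isStarNormal
  have h0 : ∀ z ∈ realInterval (α - δ) (β - γ),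
      (Polynomial.X + Polynomial.C (t : ℂ)).eval z ≠ 0 := by
    rintro _ ⟨x, hx, rfl⟩
    have : 0 < x + t := by linarith [hx.1]
    simpa using mod_cast this.ne'
  have hu := hM.isUnit_aeval h0
  have hinv : cfc (fun z => 1 / ((t : ℂ) + z)) (kroneckerSum A B) =
      (Polynomial.aeval (kroneckerSum A B) (Polynomial.X + Polynomial.C (t : ℂ)))⁻¹ := by
    rw [Matrix.nonsing_inv_eq_ringInverse, ← cfc_polynomial _ (kroneckerSum A B),
      ← cfc_inv _ (kroneckerSum A B) (fun z hz => h0 z (hM.mem_realInterval hz))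
        (Polynomial.continuous _).continuousOn]
    refine cfc_congr fun z _ => ?_
    simp [add_comm]
  rw [← Matrix.vec_inj]
  have h1 : A * kroneckerFun (fun z => 1 / ((t : ℂ) + z)) A B F -
      kroneckerFun (fun z => 1 / ((t : ℂ) + z)) A B F *
        (B - (t : ℂ) • (1 : Matrix (Fin n) (Fin n) ℂ)) =
      (A * kroneckerFun (fun z => 1 / ((t : ℂ) + z)) A B F -
      kroneckerFun (fun z => 1 / ((t : ℂ) + z)) A B F * B) +
        (t : ℂ) • kroneckerFun (fun z => 1 / ((t : ℂ) + z)) A B F := by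
    simp only [Matrix.mul_sub, Matrix.mul_smul, Matrix.mul_one]
    abel
  rw [h1, Matrix.vec_add, Matrix.vec_smul, ← kroneckerSum_mulVec_vec, kroneckerFun, vec_unvec,
    hinv]
  have h2 (x : Fin n × Fin m → ℂ) : kroneckerSum A B *ᵥ x + (t : ℂ) • x =
      Polynomial.aeval (kroneckerSum A B) (Polynomial.X + Polynomial.C (t : ℂ)) *ᵥ x := by
    simp [Matrix.add_mulVec, Algebra.algebraMap_eq_smul_one, Matrix.smul_mulVec]
  rw [h2, Matrix.mulVec_mulVec, Matrix.mul_nonsing_inv _ ((Matrix.isUnit_iff_isUnit_det _).1 hu),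
    Matrix.one_mulVec]

lemma l2_opNorm_kroneckerFun_resolvent_le {α β γ δ : ℝ} (hA : A.LoewnerIcc α β)
    (hB : B.LoewnerIcc γ δ) (h : δ < α) (F : Matrix (Fin m) (Fin n) ℂ) {t : ℝ} (ht : 0 ≤ t) :
    ‖kroneckerFun (fun z => 1 / ((t : ℂ) + z)) A B F‖ ≤ ‖F‖ / (α - δ + t) := by
  have := Matrix.sylvester_lower_bound hA (hB.sub_smul_one t)
    (kroneckerFun (fun z => 1 / ((t : ℂ) + z)) A B F)
  rw [kroneckerFun_resolvent hA hB h F ht] at this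
  rw [le_div_iff₀ (by linarith)]
  linarith

/-- The spectrum of the Kronecker sum lies in `[α - δ, ∞)`, where every resolvent function is
dominated by its value at `α - δ`. This value is integrable in `t` by the Cauchy-Stieltjes
hypothesis at that point, so the functional calculus commutes with the integral. -/
lemma kroneckerFun_eq_integral {f : ℂ → ℂ} {μ : Measure ℝ≥0}
    (hf : ∀ z ∈ Complex.slitPlane,
      Integrable (fun t : ℝ≥0 => 1 / (((t : ℝ) : ℂ) + z)) μ ∧
      f z = ∫ t : ℝ≥0, 1 / (((t : ℝ) : ℂ) + z) ∂μ)
    {α β γ δ : ℝ} (hA : A.LoewnerIcc α β) (hB : B.LoewnerIcc γ δ) (h : δ < α)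
    (F : Matrix (Fin m) (Fin n) ℂ) :
    Integrable (fun t : ℝ≥0 => kroneckerFun (fun z => 1 / (((t : ℝ) : ℂ) + z)) A B F) μ ∧
      kroneckerFun f A B F =
        ∫ t : ℝ≥0, kroneckerFun (fun z => 1 / (((t : ℝ) : ℂ) + z)) A B F ∂μ := by
  have hM := hA.kroneckerSum hB
  have hn := hM.isStarNormal
  have hpos : ∀ z ∈ spectrum ℂ (kroneckerSum A B), ∃ x : ℝ, α - δ ≤ x ∧ (x : ℂ) = z :=
    fun z hz => let ⟨x, hx, hxz⟩ := hM.mem_realInterval hz; ⟨x, hx.1, hxz⟩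
  have hslit {x : ℝ} (hx : α - δ ≤ x) : (x : ℂ) ∈ Complex.slitPlane :=
    Complex.ofReal_mem_slitPlane.2 (by linarith)
  have hcont : ContinuousOn (Function.uncurry fun (t : ℝ≥0) (z : ℂ) => 1 / (((t : ℝ) : ℂ) + z))
      (Set.univ ×ˢ spectrum ℂ (kroneckerSum A B)) := by
    refine ContinuousOn.div continuousOn_const (Continuous.continuousOn (by fun_prop)) ?_
    rintro ⟨t, z⟩ ⟨-, hz⟩
    obtain ⟨x, hx, rfl⟩ := hpos z hz
    have : 0 < (t : ℝ) + x := by linarith [t.2, t.coe_nonneg]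
    exact Complex.ofReal_add (t : ℝ) x ▸ Complex.ofReal_ne_zero.2 this.ne'
  have hbound : ∀ᵐ t : ℝ≥0 ∂μ, ∀ z ∈ spectrum ℂ (kroneckerSum A B),
      ‖1 / (((t : ℝ) : ℂ) + z)‖ ≤ ‖1 / (((t : ℝ) : ℂ) + ((α - δ : ℝ) : ℂ))‖ := by
    refine Filter.Eventually.of_forall fun t z hz => ?_
    obtain ⟨x, hx, rfl⟩ := hpos z hz
    have ht := t.coe_nonneg
    rw [← Complex.ofReal_add, ← Complex.ofReal_add, norm_div, norm_div, Complex.norm_real,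
      Complex.norm_real, norm_one, Real.norm_of_nonneg (by linarith),
      Real.norm_of_nonneg (by linarith)]
    exact one_div_le_one_div_of_le (by linarith) (by linarith)
  have hfin : HasFiniteIntegral
      (fun t : ℝ≥0 => ‖1 / (((t : ℝ) : ℂ) + ((α - δ : ℝ) : ℂ))‖) μ :=
    (hf _ (hslit le_rfl)).1.norm.2
  have hint : Integrable
      (fun t : ℝ≥0 => cfc (fun z => 1 / (((t : ℝ) : ℂ) + z)) (kroneckerSum A B)) μ :=
    integrable_cfc _ _ _ hcont hbound hfin
  let L : Matrix (Fin n × Fin m) (Fin n × Fin m) ℂ →ₗ[ℂ] Matrix (Fin m) (Fin n) ℂ :=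
    { toFun := fun M => unvec (M *ᵥ F.vec)
      map_add' := fun M N => by rw [Matrix.add_mulVec]; rfl
      map_smul' := fun c M => by rw [Matrix.smul_mulVec]; rfl }
  refine ⟨(LinearMap.toContinuousLinearMap L).integrable_comp hint, ?_⟩
  have hcfc : cfc f (kroneckerSum A B) =
      ∫ t : ℝ≥0, cfc (fun z => 1 / (((t : ℝ) : ℂ) + z)) (kroneckerSum A B) ∂μ := by
    rw [← cfc_integral _ _ _ hcont hbound hfin]
    refine cfc_congr fun z hz => ?_
    obtain ⟨x, hx, rfl⟩ := hpos z hz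
    exact (hf _ (hslit hx)).2
  calc kroneckerFun f A B F = LinearMap.toContinuousLinearMap L (cfc f (kroneckerSum A B)) := rfl
    _ = _ := by
      rw [hcfc, ← ContinuousLinearMap.integral_comp_comm _ hint]
      rfl

end KroneckerFun

/-- Error bounds for the resolvents are inherited by Cauchy-Stieltjes functions. -/
lemma l2_opNorm_kroneckerFun_sub_projectedKroneckerFun_le {n k p q : ℕ} {f : ℂ → ℂ}
    (hf : IsCauchyStieltjes f) {A B : Matrix (Fin n) (Fin n) ℂ} {α β γ δ : ℝ}
    (hA : A.LoewnerIcc α β) (hB : B.LoewnerIcc γ δ) (h : δ < α)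
    {U_F V_F : Matrix (Fin n) (Fin k) ℂ} {U : Matrix (Fin n) (Fin p) ℂ}
    {V : Matrix (Fin n) (Fin q) ℂ} (hU : Uᴴ * U = 1) (hV : Vᴴ * V = 1) {C : ℝ}
    (hC : ∀ t : ℝ, 0 ≤ t → ‖kroneckerFun (fun z => 1 / ((t : ℂ) + z)) A B (U_F * V_Fᵀ) -
      projectedKroneckerFun (fun z => 1 / ((t : ℂ) + z)) A B U_F V_F U V‖ ≤ C / (α - δ + t)) :
    ‖kroneckerFun f A B (U_F * V_Fᵀ) - projectedKroneckerFun f A B U_F V_F U V‖ ≤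
      C * (f ((α - δ : ℝ) : ℂ)).re := by
  obtain ⟨μ, hμ⟩ := hf
  obtain ⟨hXi, hX⟩ := kroneckerFun_eq_integral hμ hA hB h (U_F * V_Fᵀ)
  obtain ⟨hYi, hY⟩ := kroneckerFun_eq_integral hμ (hA.compress hU) (hB.compress hV) h
    ((Uᴴ * U_F) * (V_Fᵀ * V))
  let L : Matrix (Fin p) (Fin q) ℂ →ₗ[ℂ] Matrix (Fin n) (Fin n) ℂ :=
    { toFun := fun Y => U * Y * Vᴴ
      map_add' := fun Y Z => by rw [Matrix.mul_add, Matrix.add_mul]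
      map_smul' := fun c Y => by simp }
  have hP : projectedKroneckerFun f A B U_F V_F U V =
      ∫ t : ℝ≥0, projectedKroneckerFun (fun z => 1 / (((t : ℝ) : ℂ) + z)) A B U_F V_F U V ∂μ := by
    have := ContinuousLinearMap.integral_comp_comm (LinearMap.toContinuousLinearMap L) hYi
    rw [← hY] at this
    exact this.symm
  have hPi : Integrable (fun t : ℝ≥0 =>
      projectedKroneckerFun (fun z => 1 / (((t : ℝ) : ℂ) + z)) A B U_F V_F U V) μ :=
    (LinearMap.toContinuousLinearMap L).integrable_comp hYi
  -- The integral of `1 / (α - δ + t)` is `f(α - δ)`, so integrating the pointwise bound produces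
  -- the factor `f(α - δ)`.
  obtain ⟨hgi, hg⟩ := hμ ((α - δ : ℝ) : ℂ) (Complex.ofReal_mem_slitPlane.2 (by linarith))
  have hre (t : ℝ≥0) : (1 / (((t : ℝ) : ℂ) + ((α - δ : ℝ) : ℂ))).re = 1 / (α - δ + (t : ℝ)) := by
    rw [← Complex.ofReal_add, ← Complex.ofReal_one, ← Complex.ofReal_div, Complex.ofReal_re,
      add_comm]
  rw [hX, hP, ← integral_sub hXi hPi, hg, ← RCLike.re_eq_complex_re, ← integral_re hgi,
    ← integral_const_mul]
  refine norm_integral_le_of_norm_le (hgi.re.const_mul C) (Filter.Eventually.of_forall fun t => ?_)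
  refine (hC t t.coe_nonneg).trans_eq ?_
  rw [RCLike.re_eq_complex_re, hre, mul_one_div]

end CauchyStieltjes

/-! ### The error bound. -/

lemma Matrix.mem_spectrum_transpose {n : Type*} [Fintype n] [DecidableEq n] {A : Matrix n n ℂ}
    {z : ℂ} : z ∈ spectrum ℂ Aᵀ ↔ z ∈ spectrum ℂ A := by
  rw [spectrum.mem_iff, spectrum.mem_iff, ← Matrix.isUnit_transpose, Matrix.transpose_sub,
    Matrix.transpose_transpose, Algebra.algebraMap_eq_smul_one, Matrix.transpose_smul,
    Matrix.transpose_one]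

/-- The intervals `I_A = [α, β]` and `I_B = [γ, δ]` are any intervals that contain the spectra of
`A` and `B`, for example `[a, b]` and `[-b, -a]`. Norms are spectral norms. The complex conjugate
of `V` is an orthonormal basis of the second Krylov space, so that `V` itself spans the conjugate
of that space, which contains the columns of `(U_F V_Fᵀ)ᴴ`; for real `V` there is no
difference. -/
theorem mainTheorem9 {n k ℓ p q : ℕ} (f : ℂ → ℂ) (hf : IsCauchyStieltjes f)
    (a b : ℝ) (ha : 0 < a)
    (A B : Matrix (Fin n) (Fin n) ℂ)
    (hA : A.PosDef) (hAspec : spectrum ℝ A ⊆ Set.Icc a b)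
    (hB : (-B).PosDef) (hBspec : spectrum ℝ (-B) ⊆ Set.Icc a b)
    (α β γ δ : ℝ)
    (hIA : spectrum ℝ A ⊆ Set.Icc α β) (hIB : spectrum ℝ B ⊆ Set.Icc γ δ)
    (U_F V_F : Matrix (Fin n) (Fin k) ℂ)
    (Ψ Ξ : Fin ℓ → OnePoint ℂ)
    (hΨ : ∀ (j : Fin ℓ) (z : ℂ), Ψ j = (z : OnePoint ℂ) → z ∉ spectrum ℂ A)
    (hΞ : ∀ (j : Fin ℓ) (z : ℂ), Ξ j = (z : OnePoint ℂ) → z ∉ spectrum ℂ B)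
    (U : Matrix (Fin n) (Fin p) ℂ) (hU : IsOrthonormalBasisOf U (rationalKrylov A U_F Ψ))
    (V : Matrix (Fin n) (Fin q) ℂ)
    (hV : IsOrthonormalBasisOf (V.map star) (rationalKrylov Bᵀ V_F Ξ)) :
    ENNReal.ofReal
        ‖kroneckerFun f A B (U_F * V_Fᵀ) - projectedKroneckerFun f A B U_F V_F U V‖ ≤
      ENNReal.ofReal ((f ((2 * a : ℝ) : ℂ)).re * (1 + b / a) * ‖U_F * V_Fᵀ‖) *
        ⨆ (t : ℝ) (_ : 0 ≤ t),
          max (zolotarevTheta (realInterval α β) (realInterval (γ - t) (δ - t)) Ψ)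
            (zolotarevTheta (realInterval γ δ) (realInterval (α + t) (β + t)) Ξ) := by
  rcases Nat.eq_zero_or_pos n with rfl | hn
  · rw [Subsingleton.elim (kroneckerFun f A B (U_F * V_Fᵀ) - _) 0]
    simp
  have hab : a ≤ b := by
    have := hAspec (hA.isHermitian.eigenvalues_mem_spectrum_real ⟨0, hn⟩)
    exact this.1.trans this.2
  have hb : 0 < b := ha.trans_le hab
  have hAb : A.LoewnerIcc a b := .of_spectrum hA.isHermitian hAspec
  have hBb : B.LoewnerIcc (-b) (-a) := by
    simpa using (Matrix.LoewnerIcc.of_spectrum hB.isHermitian hBspec).neg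
  have hAI : A.LoewnerIcc α β := .of_spectrum hA.isHermitian hIA
  have hBI : B.LoewnerIcc γ δ := .of_spectrum hBb.isHermitian hIB
  have hUn := Matrix.l2_opNorm_le_one_of_conjTranspose_mul_self hU.1
  have hVV := conjTranspose_mul_self_of_map_star hV.1
  have hVn := Matrix.l2_opNorm_le_one_of_conjTranspose_mul_self hVV
  have hqA := isUnit_aeval_polePoly hΨ
  have hqB : IsUnit (Polynomial.aeval Bᵀ (polePoly Ξ)) :=
    isUnit_aeval_polePoly fun j z hj hz => hΞ j z hj (Matrix.mem_spectrum_transpose.1 hz)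
  have hAl := hAb.compress hU.1
  have hBl := hBb.compress hVV
  have h2a : a - -a = 2 * a := by ring
  have hlt : -a < a := by linarith
  have reduction {C : ℝ} (hC : ∀ t : ℝ, 0 ≤ t →
      ‖kroneckerFun (fun z => 1 / ((t : ℂ) + z)) A B (U_F * V_Fᵀ) -
        projectedKroneckerFun (fun z => 1 / ((t : ℂ) + z)) A B U_F V_F U V‖ ≤ C / (2 * a + t)) :
      ‖kroneckerFun f A B (U_F * V_Fᵀ) - projectedKroneckerFun f A B U_F V_F U V‖ ≤
        C * (f ((2 * a : ℝ) : ℂ)).re := by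
    rw [← h2a] at hC ⊢
    exact l2_opNorm_kroneckerFun_sub_projectedKroneckerFun_le hf hAb hBb hlt hU.1 hVV hC
  set S : ℝ≥0∞ := ⨆ (t : ℝ) (_ : 0 ≤ t),
    max (zolotarevTheta (realInterval α β) (realInterval (γ - t) (δ - t)) Ψ)
      (zolotarevTheta (realInterval γ δ) (realInterval (α + t) (β + t)) Ξ) with hS
  have hκ : 0 < 1 + b / a := by positivity
  -- Since `0 * ∞ = 0` in `ℝ≥0∞`, an infinite supremum does not settle the claim when the constant
  -- in front is zero. A crude bound by `2 ‖F‖ f(2a)`, from the norms of the two resolvent solutions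
  -- separately, shows that the error then vanishes.
  by_cases htop : S = ∞
  · have hcrude := reduction (C := 2 * ‖U_F * V_Fᵀ‖) fun t ht => by
      have h1 := l2_opNorm_kroneckerFun_resolvent_le hAb hBb hlt (U_F * V_Fᵀ) ht
      have h2 := l2_opNorm_kroneckerFun_resolvent_le hAl hBl hlt ((Uᴴ * U_F) * (V_Fᵀ * V)) ht
      have h3 : ‖(Uᴴ * U_F) * (V_Fᵀ * V)‖ ≤ 1 * ‖U_F * V_Fᵀ‖ * 1 := by
        rw [Matrix.mul_assoc, ← Matrix.mul_assoc U_F, ← Matrix.mul_assoc]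
        exact Matrix.l2_opNorm_mul_le_of_le (Matrix.l2_opNorm_mul_le_of_le
          ((Matrix.l2_opNorm_conjTranspose U).trans_le hUn) le_rfl) hVn
      have h4 := Matrix.l2_opNorm_mul_le_of_le (Matrix.l2_opNorm_mul_le_of_le hUn h2)
        ((Matrix.l2_opNorm_conjTranspose V).trans_le hVn)
      rw [one_mul, mul_one] at h3 h4
      rw [h2a] at h1 h4
      refine (norm_sub_le _ _).trans ((add_le_add h1 (h4.trans
        (div_le_div_of_nonneg_right h3 (by linarith)))).trans_eq ?_)
      ring
    rw [htop]
    rcases le_or_gt ((f ((2 * a : ℝ) : ℂ)).re * (1 + b / a) * ‖U_F * V_Fᵀ‖) 0 with hK | hK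
    · have h0 : ‖U_F * V_Fᵀ‖ * (f ((2 * a : ℝ) : ℂ)).re ≤ 0 := by
        by_contra! hpos
        nlinarith [mul_pos hpos hκ]
      rw [ENNReal.ofReal_of_nonpos (by linarith)]
      exact zero_le
    · rw [ENNReal.mul_top (ENNReal.ofReal_pos.2 hK).ne']
      exact le_top
  · have hle (t : ℝ) (ht : 0 ≤ t) :
        max (zolotarevTheta (realInterval α β) (realInterval (γ - t) (δ - t)) Ψ)
          (zolotarevTheta (realInterval γ δ) (realInterval (α + t) (β + t)) Ξ) ≤
        ENNReal.ofReal S.toReal := by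
      rw [ENNReal.ofReal_toReal htop, hS]
      exact le_iSup₂_of_le t ht le_rfl
    -- The spectral gap and the norm bounds use `[a, b]` and `[-b, -a]`; the freely chosen intervals
    -- enter only through `θ_ℓ`.
    have hmain := reduction (C := (1 + b / a) * ‖U_F * V_Fᵀ‖ * S.toReal) fun t ht =>
      l2_opNorm_sub_galerkin_le ha hb.le ht hAb hBb hAI hBI hqA hqB hU hV
        (kroneckerFun_resolvent hAb hBb hlt _ ht) (kroneckerFun_resolvent hAl hBl hlt _ ht)
        ENNReal.toReal_nonneg ((le_max_left _ _).trans (hle t ht))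
        ((le_max_right _ _).trans (hle t ht))
    rw [← ENNReal.ofReal_toReal htop, ← ENNReal.ofReal_mul' ENNReal.toReal_nonneg]
    refine ENNReal.ofReal_le_ofReal (hmain.trans_eq ?_)
    ring
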